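/- Let $\Delta$ be a finite simplicial complex (with $\emptyset\in\Delta$) of dimension $d-1$ on a finite linearly ordered ground set $V$, where $d\ge 0$. Let $f_{i-1}^\Delta$ be the number of faces with $i$ elements (so $f_{-1}^\Delta=1$), and define the $h$-vector $h^\Delta=(h_0^\Delta,\dots,h_d^\Delta)$ by $\sum_{i=0}^d h_i^\Delta x^{d-i}=\sum_{i=0}^d f_{i-1}^\Delta (x-1)^{d-i}$. Consider the conditions $$h_0^\Delta,\dots,h_d^\Delta>0\quad\text{and}\quad \frac{h_0^\Delta}{h_d^\Delta}\le\frac{h_1^\Delta}{h_{d-1}^\Delta}\le\cdots\le\frac{h_d^\Delta}{h_0^\Delta},\tag{1}$$ $$h_1^\Delta,\dots,h_{d-1}^\Delta>0,\quad h_d^\Delta=0\quad\text{and}\quad \frac{h_1^\Delta}{h_{d-1}^\Delta}\ge\frac{h_2^\Delta}{h_{d-2}^\Delta}\ge\cdots\ge\frac{h_{d-1}^\Delta}{h_1^\Delta}.\tag{2}$$ For an integer $r\ge 1$, the $r$-th edgewise subdivision $\Delta^{\langle r\rangle}$ is the simplicial complex whose vertices are the vectors $a\in\mathbb{N}^V$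 with $\sum_{v}a_v=r$ and $\operatorname{supp}(a)\in\Delta$, and in which a finite set $A$ of vertices is a face if and only if $\bigcup_{a\in A}\operatorname{supp}(a)\in\Delta$ and, for all $a,b\in A$, one of $\iota(a)-\iota(b)$ and $\iota(b)-\iota(a)$ has all its coordinates in $\{0,1\}$; here $\iota(a)_v=\sum_{w\le v}a_w$. Then for every $r\ge 1$: if $\Delta$ satisfies (1), then $\Delta^{\langle r\rangle}$ satisfies (1); and if $\Delta$ satisfies (2), then $\Delta^{\langle r\rangle}$ satisfies (2). -/

import Mathlib

namespace SimplicialHVector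

open Polynomial

/-! Finite simplicial complexes are Mathlib's `PreAbstractSimplicialComplex`es on a finite ground
set (not every element of the ground set has to be a vertex). Mathlib lists only the nonempty
faces; the empty face, of dimension `-1`, is always counted below, so `f_{-1} = 1`, and the complex
without nonempty faces is the `(-1)`-dimensional complex `{∅}`. -/

/-- The number `d` such that the complex has dimension `d - 1`:
the largest number of vertices of a face. -/
noncomputable def rank {V : Type*} (K : PreAbstractSimplicialComplex V) : ℕ :=
  sSup (Finset.card '' K.faces)

/-- `faceCount K i` is the number `f_{i-1}` of faces with `i` vertices (that is, of dimension
`i - 1`), the empty face included. -/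
noncomputable def faceCount {V : Type*} (K : PreAbstractSimplicialComplex V) (i : ℕ) : ℕ :=
  {s : Finset V | (s = ∅ ∨ s ∈ K.faces) ∧ s.card = i}.ncard

/-- The `f`-polynomial `∑_{i=0}^d f_{i-1} x^{d-i}`. -/
noncomputable def fPoly {V : Type*} (K : PreAbstractSimplicialComplex V) : ℤ[X] :=
  ∑ i ∈ Finset.range (rank K + 1), C (faceCount K i : ℤ) * X ^ (rank K - i)

/-- The `h`-polynomial `h(x) = f(x - 1)`. -/
noncomputable def hPoly {V : Type*} (K : PreAbstractSimplicialComplex V) : ℤ[X] :=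
  (fPoly K).comp (X - 1)

/-- The entry `h_i` of the `h`-vector (for `0 ≤ i ≤ d`), where `h(x) = ∑_{i=0}^d h_i x^{d-i}`,
as a rational number. -/
noncomputable def h {V : Type*} (K : PreAbstractSimplicialComplex V) (i : ℕ) : ℚ :=
  ((hPoly K).coeff (rank K - i) : ℤ)

/-- `h_0, …, h_d > 0` and `h_0 / h_d ≤ h_1 / h_{d-1} ≤ ⋯ ≤ h_d / h_0`. -/
def IncreasingRatios {V : Type*} (K : PreAbstractSimplicialComplex V) : Prop :=
  (∀ i, i ≤ rank K → 0 < h K i) ∧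
    ∀ i, i + 1 ≤ rank K →
      h K i / h K (rank K - i) ≤ h K (i + 1) / h K (rank K - (i + 1))

/-- `h_1, …, h_{d-1} > 0`, `h_d = 0` and
`h_1 / h_{d-1} ≥ h_2 / h_{d-2} ≥ ⋯ ≥ h_{d-1} / h_1`. -/
def DecreasingRatios {V : Type*} (K : PreAbstractSimplicialComplex V) : Prop :=
  (∀ i, 1 ≤ i → i + 1 ≤ rank K → 0 < h K i) ∧
    h K (rank K) = 0 ∧
    ∀ i, 1 ≤ i → i + 2 ≤ rank K →
      h K i / h K (rank K - i) ≥ h K (i + 1) / h K (rank K - (i + 1))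

section Edgewise

variable {V : Type*} [Fintype V]

/-- The support of a vector `a ∈ ℕ^V`. -/
def supp (a : V → ℕ) : Finset V := Finset.univ.filter fun v => a v ≠ 0

variable [LinearOrder V]

/-- The vector of partial sums: for `V = {v_1 < ⋯ < v_n}`,
`ι(a) = (a_1, a_1 + a_2, …, a_1 + ⋯ + a_n)`. -/
def partialSums (a : V → ℕ) (v : V) : ℤ :=
  ∑ w ∈ Finset.univ.filter (fun w => w ≤ v), (a w : ℤ)

/-- The `r`-th edgewise subdivision (for `r ≥ 1`) of a complex `K` on the linearly ordered finite
ground set `V`. Its vertices are the vectors `a ∈ ℕ^V` with coordinate sum `r` whose support is a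
face of `K`; a nonempty finite set `A` of these is a face if the union of the supports of
its elements is a face of `K` and, for all `a, b ∈ A`, one of `ι(a) - ι(b)` and `ι(b) - ι(a)`
is a `0/1`-vector. -/
def edgewise (r : ℕ) (K : PreAbstractSimplicialComplex V) :
    PreAbstractSimplicialComplex (V → ℕ) where
  faces := {A | A.Nonempty ∧
    (∀ a ∈ A, ∑ v, a v = r ∧ supp a ∈ K.faces) ∧
    A.biUnion supp ∈ K.faces ∧
    ∀ a ∈ A, ∀ b ∈ A,
      (∀ v, partialSums a v - partialSums b v ∈ ({0, 1} : Set ℤ)) ∨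
      (∀ v, partialSums b v - partialSums a v ∈ ({0, 1} : Set ℤ))}
  isRelLowerSet_faces := by
    rintro A ⟨hA, hv, hu, hs⟩
    refine ⟨hA, fun B hBA hB => ⟨hB, fun a ha => hv a (hBA ha), ?_,
      fun a ha b hb => hs a (hBA ha) b (hBA hb)⟩⟩
    refine (K.isRelLowerSet_faces hu).2 (Finset.biUnion_subset_biUnion_of_subset_left _ hBA) ?_
    obtain ⟨a, ha⟩ := hB
    exact (K.isRelLowerSet_faces (hv a (hBA ha)).2).1.mono (Finset.subset_biUnion_of_mem supp ha)

end Edgewise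

end SimplicialHVector

/-! Write d = `rank K`. The Hilbert series counting monomials supported on faces equals (∑ h_i x^i)
/ (1 - x)^d. A multiset of n vectors forming a face of the subdivision is determined by its total,
and every vector with coordinate sum rn supported on a face of K (n ≥ 1) is such a total. So
subdividing replaces the Hilbert function H(n) by H(rn) (`hilbertFunction_edgewise`).

Sampling every r-th coefficient of the series gives h'_i = ∑_k T(ri, k) h_k, where T is the Toeplitz
matrix of (1 + x + ⋯ + x^(r-1))^d. This polynomial is palindromic, so h'_(d-i) = ∑_k T(ri, k)
h_(d-k) with the same row of T (`h_edgewise_reverse`).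

After clearing denominators, (1) and (2) concern the signs of the 2 × 2 minors of the matrix with
columns (h_(d-k)) and (h_k). The 2 × 2 minors of T are nonnegative (`toeplitz_minor_nonneg`), so by
Cauchy-Binet these signs pass from h to h'. -/

namespace SimplicialHVector

open Polynomial

/-! ### Hilbert series and the h-vector -/

/-- The number of monomials of degree `n` whose support is a face. -/
noncomputable def hilbertFunction {V : Type*} (K : PreAbstractSimplicialComplex V) (n : ℕ) : ℕ :=
  {l : V →₀ ℕ | (l.support = ∅ ∨ l.support ∈ K.faces) ∧ l.degree = n}.ncard

/-- The polynomial `∑ h_i x^i`, with coefficients listed from `h_0` on. -/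
noncomputable def hRev {V : Type*} (K : PreAbstractSimplicialComplex V) : ℚ[X] :=
  ∑ i ∈ Finset.range (rank K + 1), C (faceCount K i : ℚ) * (X ^ i * (1 - X) ^ (rank K - i))

section

variable {V : Type*} {K : PreAbstractSimplicialComplex V}

lemma reflect_X_sub_one_pow (n : ℕ) :
    reflect n ((X - 1 : ℚ[X]) ^ n) = (1 - X) ^ n := by
  induction n with
  | zero => simp
  | succ n ih =>
    have hdeg : (X - 1 : ℚ[X]).natDegree ≤ 1 := by
      simpa using (natDegree_X_sub_C_le (1 : ℚ))
    have h1 : reflect 1 (X - 1 : ℚ[X]) = 1 - X := by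
      rw [reflect_sub]
      simp
    rw [pow_succ, reflect_mul _ _ ((natDegree_pow_le).trans (by nlinarith)) hdeg, ih, h1, pow_succ]

lemma reflect_X_sub_one_pow_of_le {n i : ℕ} (hi : i ≤ n) :
    reflect n ((X - 1 : ℚ[X]) ^ (n - i)) = X ^ i * (1 - X) ^ (n - i) := by
  have hdeg : (X - 1 : ℚ[X]).natDegree ≤ 1 := by
    simpa using (natDegree_X_sub_C_le (1 : ℚ))
  have h0 := reflect_mul (1 : ℚ[X]) ((X - 1 : ℚ[X]) ^ (n - i)) (F := i) (G := n - i)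
    (by simp) ((natDegree_pow_le).trans (by nlinarith))
  have h' := reflect_C_mul_X_pow (R := ℚ) i 0 (c := 1)
  simp only [map_one, pow_zero, one_mul, mul_one, revAt_le (Nat.zero_le i), Nat.sub_zero] at h'
  rwa [one_mul, h', reflect_X_sub_one_pow, Nat.add_sub_cancel' hi] at h0

lemma h_eq_coeff_hRev {i : ℕ} (hi : i ≤ rank K) : h K i = (hRev K).coeff i := by
  have hmap : (hPoly K).map (Int.castRingHom ℚ) =
      ∑ i ∈ Finset.range (rank K + 1), C (faceCount K i : ℚ) * (X - 1) ^ (rank K - i) := by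
    simp [hPoly, fPoly, Polynomial.map_sum, Polynomial.sum_comp]
  have hrefl : hRev K = reflect (rank K) ((hPoly K).map (Int.castRingHom ℚ)) := by
    ext j
    rw [hmap, hRev, coeff_reflect, finsetSum_coeff, finsetSum_coeff]
    refine Finset.sum_congr rfl fun i hi => ?_
    rw [coeff_C_mul, coeff_C_mul, ← reflect_X_sub_one_pow_of_le
      (Nat.lt_succ_iff.1 (Finset.mem_range.1 hi)), coeff_reflect]
  rw [hrefl, coeff_reflect, revAt_le hi, coeff_map, h]
  simp

lemma natDegree_hRev_le : (hRev K).natDegree ≤ rank K := by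
  refine natDegree_sum_le_of_forall_le _ _ fun i hi => ?_
  have hdeg : (1 - X : ℚ[X]).natDegree ≤ 1 := by
    rw [natDegree_sub]
    simpa using (natDegree_X_sub_C_le (1 : ℚ))
  have h1 : ((1 - X : ℚ[X]) ^ (rank K - i)).natDegree ≤ rank K - i :=
    natDegree_pow_le.trans (by nlinarith)
  have h2 := natDegree_mul_le_of_le (natDegree_X_pow_le (R := ℚ) i) h1
  have hi := Finset.mem_range.1 hi
  exact (natDegree_C_mul_le _ _).trans (h2.trans (by omega))

lemma card_le_rank (hK : K.faces.Finite) {s : Finset V} (hs : s ∈ K.faces) :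
    s.card ≤ rank K :=
  le_csSup (hK.image _).bddAbove ⟨s, hs, rfl⟩

lemma finite_faces_with_card (hK : K.faces.Finite) (i : ℕ) :
    {s : Finset V | (s = ∅ ∨ s ∈ K.faces) ∧ s.card = i}.Finite :=
  (hK.insert ∅).subset fun _ hs => hs.1

lemma faceCount_rank_pos (hK : K.faces.Finite) : 0 < faceCount K (rank K) := by
  rw [faceCount, Set.ncard_pos (finite_faces_with_card hK _)]
  rcases K.faces.eq_empty_or_nonempty with h0 | h0
  · exact ⟨∅, Or.inl rfl, by simp [rank, h0]⟩
  · obtain ⟨s, hs, h1⟩ := Nat.sSup_mem (h0.image Finset.card) (hK.image _).bddAbove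
    exact ⟨s, Or.inr hs, h1⟩

/-- Only the term without a factor 1 - x survives. Since this value is nonzero, `rank K` is the
exact order of the pole of the Hilbert series at 1. -/
lemma eval_one_hRev : (hRev K).eval 1 = faceCount K (rank K) := by
  rw [hRev, eval_finsetSum, Finset.sum_eq_single (rank K)]
  · simp
  · intro i hi hne
    have : rank K - i ≠ 0 := by have := Finset.mem_range.1 hi; omega
    simp [this]
  · simp

open Classical in
lemma hilbertFunction_eq_sum {D : Finset (Finset V)} (hD : ∀ s, s ∈ D ↔ s = ∅ ∨ s ∈ K.faces)
    (n : ℕ) : hilbertFunction K n =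
      ∑ s ∈ D, ((s.finsuppAntidiag n).filter fun l : V →₀ ℕ => ∀ i ∈ s, l i ≠ 0).card := by
  have hmem : ∀ (s : Finset V) (l : V →₀ ℕ),
      l ∈ (s.finsuppAntidiag n).filter (fun l : V →₀ ℕ => ∀ i ∈ s, l i ≠ 0) ↔
        l.support = s ∧ l.degree = n := by
    intro s l
    rw [Finset.mem_filter, Finset.mem_finsuppAntidiag, Finsupp.degree_apply]
    constructor
    · rintro ⟨⟨h1, h2⟩, h3⟩
      have : l.support = s := h2.antisymm fun i hi => by simpa using h3 i hi
      exact ⟨this, by rw [this]; exact h1⟩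
    · rintro ⟨rfl, h2⟩
      exact ⟨⟨h2, subset_rfl⟩, fun i hi => by simpa using hi⟩
  rw [← Finset.card_biUnion, hilbertFunction, ← Set.ncard_coe_finset]
  · congr 1
    ext l
    simp only [Set.mem_ofPred_eq, Finset.coe_biUnion, Set.mem_iUnion, Finset.mem_coe, hmem,
      ← hD]
    constructor
    · rintro ⟨h1, h2⟩
      exact ⟨_, h1, rfl, h2⟩
    · rintro ⟨s, h1, rfl, h2⟩
      exact ⟨h1, h2⟩
  · intro s _ t _ hst
    rw [Function.onFun, Finset.disjoint_left]
    intro l h1 h2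
    exact hst (((hmem s l).1 h1).1.symm.trans ((hmem t l).1 h2).1)

-- The series x / (1 - x) enumerates the positive exponents, one factor for each element of `s`.
open Classical in
lemma coeff_X_mul_geom_pow_card (s : Finset V) (n : ℕ) :
    PowerSeries.coeff n ((PowerSeries.X * PowerSeries.mk 1 : PowerSeries ℚ) ^ s.card) =
      ((s.finsuppAntidiag n).filter fun l : V →₀ ℕ => ∀ i ∈ s, l i ≠ 0).card := by
  rw [← Finset.prod_const, PowerSeries.coeff_prod, Finset.card_filter, Nat.cast_sum]
  refine Finset.sum_congr rfl fun l _ => ?_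
  have : ∀ m : ℕ, PowerSeries.coeff m (PowerSeries.X * PowerSeries.mk 1 : PowerSeries ℚ) =
      if m ≠ 0 then 1 else 0 := by
    rintro (_ | m)
    · simp
    · rw [mul_comm, PowerSeries.coeff_succ_mul_X]; simp
  simp_rw [this]
  rw [Finset.prod_boole]
  push_cast
  rfl

/-- The Hilbert series of a complex is `(∑ h_i x^i) / (1 - x)^d`. -/
lemma one_sub_X_pow_mul_hilbertSeries (hK : K.faces.Finite) :
    (1 - PowerSeries.X) ^ rank K * PowerSeries.mk (fun n => (hilbertFunction K n : ℚ)) =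
      (hRev K : PowerSeries ℚ) := by
  classical
  set D : Finset (Finset V) := (hK.insert ∅).toFinset with hDdef
  have hD : ∀ s, s ∈ D ↔ s = ∅ ∨ s ∈ K.faces := by simp [hDdef]
  have hrank : ∀ s ∈ D, s.card ≤ rank K := by
    intro s hs
    rcases (hD s).1 hs with rfl | hs
    · simp
    · exact card_le_rank hK hs
  have hser : PowerSeries.mk (fun n => (hilbertFunction K n : ℚ)) =
      ∑ s ∈ D, (PowerSeries.X * PowerSeries.mk 1) ^ s.card := by
    ext n
    rw [PowerSeries.coeff_mk, map_sum, hilbertFunction_eq_sum hD, Nat.cast_sum]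
    exact Finset.sum_congr rfl fun s _ => (coeff_X_mul_geom_pow_card s n).symm
  have hcount : ∀ i, (faceCount K i : ℚ) = ∑ s ∈ D, if s.card = i then 1 else 0 := by
    intro i
    rw [faceCount, Finset.sum_boole, ← Set.ncard_coe_finset]
    congr 2
    ext s
    simp [hD]
  have hgeom : ∀ k ≤ rank K, (1 - PowerSeries.X : PowerSeries ℚ) ^ rank K *
      (PowerSeries.X * PowerSeries.mk 1) ^ k =
        PowerSeries.X ^ k * (1 - PowerSeries.X) ^ (rank K - k) := by
    intro k hk
    obtain ⟨e, he⟩ := Nat.exists_eq_add_of_le hk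
    have h1 : (PowerSeries.mk 1 : PowerSeries ℚ) ^ k * (1 - PowerSeries.X) ^ k = 1 := by
      rw [← mul_pow, PowerSeries.mk_one_mul_one_sub_eq_one, one_pow]
    rw [he, Nat.add_sub_cancel_left, pow_add, mul_pow]
    linear_combination (PowerSeries.X ^ k * (1 - PowerSeries.X) ^ e) * h1
  have hpoly : hRev K = ∑ s ∈ D, X ^ s.card * (1 - X) ^ (rank K - s.card) := by
    simp_rw [hRev, hcount, map_sum, Finset.sum_mul]
    rw [Finset.sum_comm]
    refine Finset.sum_congr rfl fun s hs => ?_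
    rw [Finset.sum_eq_single s.card]
    · simp
    · intro i _ hi
      simp [hi.symm]
    · intro h0
      exact absurd (Finset.mem_range.2 (Nat.lt_succ_of_le (hrank s hs))) h0
  rw [hser, hpoly, Finset.mul_sum]
  have hcoe : ((∑ s ∈ D, X ^ s.card * (1 - X) ^ (rank K - s.card) : ℚ[X]) : PowerSeries ℚ) =
      ∑ s ∈ D, ((X ^ s.card * (1 - X) ^ (rank K - s.card) : ℚ[X]) : PowerSeries ℚ) :=
    map_sum (Polynomial.coeToPowerSeries.ringHom (R := ℚ)) _ _
  rw [hcoe]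
  refine Finset.sum_congr rfl fun s hs => ?_
  rw [hgeom _ (hrank s hs)]
  simp

end

/-! ### Unique decomposition of a vector by rounding its partial sums -/

/-- Hermite's identity: passing from x to x + 1 trades the summand x / n for (x + n) / n = x / n +
1. -/
lemma sum_add_div_eq {n : ℕ} (hn : 0 < n) (x : ℕ) :
    ∑ j ∈ Finset.range n, (x + j) / n = x := by
  induction x with
  | zero =>
    refine Finset.sum_eq_zero fun j hj => ?_
    rw [zero_add]
    exact Nat.div_eq_of_lt (Finset.mem_range.1 hj)
  | succ x ih =>
    have h1 := Finset.sum_range_succ (fun j => (x + j) / n) n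
    have h2 := Finset.sum_range_succ' (fun j => (x + j) / n) n
    have h3 : (x + n) / n = x / n + 1 := Nat.add_div_right x hn
    have h4 : ∀ j, x + 1 + j = x + (j + 1) := fun j => by ring
    simp_rw [h4]
    simp only [add_zero] at h2
    omega

/-- A weakly increasing sequence of `n` integers in an interval of length one is determined by
its sum. -/
lemma eq_add_div_of_monotone {n : ℕ} (x : Fin n → ℕ)
    (hx : ∀ i j, i ≤ j → x i ≤ x j ∧ x j ≤ x i + 1) (j : Fin n) :
    x j = (∑ i, x i + j) / n := by
  have hn : 0 < n := j.pos
  have hconst : ∑ _i : Fin n, x j = n * x j := by simp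
  have hlt : ∑ i : Fin n, (if i < j then 1 else 0) = (j : ℕ) := by
    rw [Finset.sum_boole, ← Fin.card_Iio j, Nat.cast_id]
    congr 1
    ext i; simp
  have hgt : ∑ i : Fin n, (if j < i then 1 else 0) = n - 1 - (j : ℕ) := by
    rw [Finset.sum_boole, ← Fin.card_Ioi j, Nat.cast_id]
    congr 1
    ext i; simp
  -- Terms before `j` are at least x_j - 1 and terms after it at most x_j + 1. So ∑ x + j lies
  -- between n x_j and n x_j + n - 1.
  have h1 : n * x j ≤ ∑ i, x i + j := by
    rw [← hconst, ← hlt, ← Finset.sum_add_distrib]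
    refine Finset.sum_le_sum fun i _ => ?_
    rcases lt_or_ge i j with h | h
    · simpa [h] using (hx i j h.le).2
    · simpa [h.not_gt] using (hx j i h).1
  have h2 : ∑ i, x i ≤ n * x j + (n - 1 - (j : ℕ)) := by
    rw [← hconst, ← hgt, ← Finset.sum_add_distrib]
    refine Finset.sum_le_sum fun i _ => ?_
    rcases lt_or_ge j i with h | h
    · simpa [h] using (hx j i h.le).2
    · simpa [h.not_gt] using (hx i j h).1
  have := j.isLt
  symm
  rw [Nat.div_eq_iff hn]
  constructor
  · rw [mul_comm]; omega
  · rw [mul_comm]; omega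

section

variable {V : Type*} [LinearOrder V]

/-- The sum telescopes along the order of `s`; monotonicity of `f` keeps the natural subtractions
from truncating. -/
lemma sum_sub_telescope {f : ℕ → ℕ} (hf : Monotone f) (a : V → ℕ) (s : Finset V) :
    ∑ w ∈ s, (f (∑ u ∈ s.filter (· ≤ w), a u) - f (∑ u ∈ s.filter (· < w), a u)) + f 0 =
      f (∑ u ∈ s, a u) := by
  induction s using Finset.induction_on_max with
  | empty => simp
  | insert m s hm ih =>
    have hms : m ∉ s := fun h => (hm m h).false
    rw [Finset.sum_insert hms]
    have h1 : (insert m s).filter (· ≤ m) = insert m s := by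
      refine Finset.filter_true_of_mem fun x hx => ?_
      rcases Finset.mem_insert.1 hx with rfl | hx
      exacts [le_rfl, (hm x hx).le]
    have h2 : (insert m s).filter (· < m) = s := by
      rw [Finset.filter_insert, if_neg (lt_irrefl m)]
      exact Finset.filter_true_of_mem hm
    have h3 : ∑ w ∈ s, (f (∑ u ∈ (insert m s).filter (· ≤ w), a u) -
        f (∑ u ∈ (insert m s).filter (· < w), a u)) =
        ∑ w ∈ s, (f (∑ u ∈ s.filter (· ≤ w), a u) - f (∑ u ∈ s.filter (· < w), a u)) := by
      refine Finset.sum_congr rfl fun w hw => ?_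
      rw [Finset.filter_insert, if_neg (hm w hw).not_ge, Finset.filter_insert,
        if_neg (hm w hw).not_gt]
    have h4 : f (∑ u ∈ s, a u) ≤ f (∑ u ∈ insert m s, a u) :=
      hf (Finset.sum_le_sum_of_subset (Finset.subset_insert m s))
    rw [h1, h2, h3]
    omega

variable [Fintype V]

/-- The partial sums over `w ≤ v`, as natural numbers. -/
def sumLE (a : V → ℕ) (v : V) : ℕ := ∑ w ∈ Finset.univ.filter (· ≤ v), a w

/-- The partial sums over `w < v`. -/
def sumLT (a : V → ℕ) (v : V) : ℕ := ∑ w ∈ Finset.univ.filter (· < v), a w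

lemma partialSums_eq (a : V → ℕ) (v : V) : partialSums a v = (sumLE a v : ℤ) := by
  simp [partialSums, sumLE]

lemma sumLE_eq (a : V → ℕ) (v : V) : sumLE a v = sumLT a v + a v := by
  have : (Finset.univ.filter (· ≤ v) : Finset V) = insert v (Finset.univ.filter (· < v)) := by
    ext w; simp [le_iff_eq_or_lt]
  rw [sumLE, this, Finset.sum_insert (by simp), sumLT, add_comm]

lemma sumLE_injective : Function.Injective (sumLE : (V → ℕ) → V → ℕ) := by
  intro a b hab
  funext v
  induction v using WellFoundedLT.induction with
  | ind v ih =>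
    have h1 : sumLT a v = sumLT b v :=
      Finset.sum_congr rfl fun w hw => ih w (Finset.mem_filter.1 hw).2
    have h2 := congrFun hab v
    rw [sumLE_eq, sumLE_eq] at h2
    omega

/-- The `j`-th vector in the decomposition of `a` as a sum of `n` vectors with
increasing partial sums. -/
def part (n : ℕ) (a : V → ℕ) (j : ℕ) (v : V) : ℕ :=
  (sumLE a v + j) / n - (sumLT a v + j) / n

lemma monotone_add_div (n j : ℕ) : Monotone fun x : ℕ => (x + j) / n :=
  fun _ _ hxy => Nat.div_le_div_right (Nat.add_le_add_right hxy j)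

/-- `part` takes differences of rounded partial sums, so summing recovers the rounding; `j < n`
makes the initial value (0 + j) / n vanish. -/
lemma sumLE_part {n j : ℕ} (hj : j < n) (a : V → ℕ) (v : V) :
    sumLE (part n a j) v = (sumLE a v + j) / n := by
  have h1 := sum_sub_telescope (monotone_add_div n j) a (Finset.univ.filter (· ≤ v))
  simp only [zero_add, Nat.div_eq_of_lt hj, add_zero] at h1
  rw [sumLE, sumLE, ← h1]
  refine Finset.sum_congr rfl fun w hw => ?_
  have hwv : w ≤ v := (Finset.mem_filter.1 hw).2
  rw [part, sumLE, sumLT, Finset.filter_filter, Finset.filter_filter]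
  congr 5
  · ext u; simpa using fun h => h.trans hwv
  · ext u; simpa using fun h => h.le.trans hwv

lemma sum_part {n j : ℕ} (hj : j < n) (a : V → ℕ) :
    ∑ v, part n a j v = (∑ v, a v + j) / n := by
  have h1 := sum_sub_telescope (monotone_add_div n j) a Finset.univ
  simp only [zero_add, Nat.div_eq_of_lt hj, add_zero] at h1
  exact h1

lemma sum_range_part {n : ℕ} (hn : 0 < n) (a : V → ℕ) (v : V) :
    ∑ j ∈ Finset.range n, part n a j v = a v := by
  have h1 : ∑ j ∈ Finset.range n, part n a j v + ∑ j ∈ Finset.range n, (sumLT a v + j) / n =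
      ∑ j ∈ Finset.range n, (sumLE a v + j) / n := by
    rw [← Finset.sum_add_distrib]
    refine Finset.sum_congr rfl fun j _ => Nat.sub_add_cancel ?_
    exact monotone_add_div n j (by rw [sumLE_eq]; omega)
  rw [sum_add_div_eq hn, sum_add_div_eq hn, sumLE_eq] at h1
  omega

lemma sumLE_sum {ι : Type*} (s : Finset ι) (b : ι → V → ℕ) (v : V) :
    sumLE (∑ i ∈ s, b i) v = ∑ i ∈ s, sumLE (b i) v := by
  simp only [sumLE, Finset.sum_apply]
  exact Finset.sum_comm

omit [LinearOrder V] in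
lemma mem_supp {a : V → ℕ} {v : V} : v ∈ supp a ↔ a v ≠ 0 := by simp [supp]

/-- The total of a multiset of vectors. -/
def total (l : (V → ℕ) →₀ ℕ) : V → ℕ := l.sum fun b m => m • b

omit [LinearOrder V] [Fintype V] in
lemma total_add (l m : (V → ℕ) →₀ ℕ) : total (l + m) = total l + total m :=
  Finsupp.sum_add_index' (by simp) (by intros; rw [add_smul])

omit [LinearOrder V] [Fintype V] in
lemma total_sum_single {ι : Type*} (s : Finset ι) (b : ι → V → ℕ) :
    total (∑ i ∈ s, Finsupp.single (b i) 1) = ∑ i ∈ s, b i := by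
  classical
  induction s using Finset.induction_on with
  | empty => simp [total]
  | insert i s hi ih =>
    rw [Finset.sum_insert hi, Finset.sum_insert hi, total_add, ih]
    simp [total]

/-- A multiset of size `n` comes from an `n`-tuple along which a given function is weakly
increasing. -/
lemma exists_monotone_tuple {W : Type*} (s : W → ℕ) (l : W →₀ ℕ) :
    ∃ b : Fin l.degree → W, l = ∑ i, Finsupp.single (b i) 1 ∧ Monotone (s ∘ b) := by
  classical
  have h0 : ∃ b : Fin l.degree → W, l = ∑ i, Finsupp.single (b i) 1 := by
    induction l using Finsupp.induction_linear with
    | zero => exact ⟨fun i => (Fin.elim0 (by simpa using i)), by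
        rw [Finset.sum_eq_zero]; intro i; exact (Fin.elim0 (by simpa using i))⟩
    | add f g hf hg =>
      obtain ⟨b, hb⟩ := hf
      obtain ⟨c, hc⟩ := hg
      rw [map_add]
      refine ⟨Fin.append b c, ?_⟩
      rw [Fin.sum_univ_add]
      simp only [Fin.append_left, Fin.append_right]
      rw [← hb, ← hc]
    | single a m =>
      refine ⟨fun _ => a, ?_⟩
      simp
  obtain ⟨b, hb⟩ := h0
  refine ⟨b ∘ Tuple.sort (s ∘ b), ?_, Tuple.monotone_sort (s ∘ b)⟩
  conv_lhs => rw [hb]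
  exact (Equiv.sum_comp (Tuple.sort (s ∘ b)) fun i => Finsupp.single (b i) 1).symm

lemma finite_faces_edgewise (r : ℕ) (K : PreAbstractSimplicialComplex V) :
    (edgewise r K).faces.Finite := by
  have h1 : {a : V → ℕ | ∑ v, a v = r}.Finite := by
    refine (Set.finite_Iic (fun _ : V => r)).subset fun a ha v => ?_
    rw [← (show ∑ v, a v = r from ha)]
    exact Finset.single_le_sum (fun _ _ => Nat.zero_le _) (Finset.mem_univ v)
  refine (h1.toFinset.powerset.finite_toSet).subset fun A hA => ?_
  rw [Finset.mem_coe, Finset.mem_powerset]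
  intro a ha
  simpa using (hA.2.1 a ha).1

lemma face_of_subset {W : Type*} {K : PreAbstractSimplicialComplex W} {s t : Finset W}
    (hs : s ∈ K.faces) (hts : t ⊆ s) (ht : t.Nonempty) : t ∈ K.faces :=
  (K.isRelLowerSet_faces hs).2 hts ht

lemma hilbertFunction_zero {W : Type*} (K : PreAbstractSimplicialComplex W) :
    hilbertFunction K 0 = 1 := by
  rw [hilbertFunction, Set.ncard_eq_one]
  refine ⟨0, ?_⟩
  ext l
  simp only [Set.mem_ofPred_eq, Set.mem_singleton_iff, Finsupp.degree_eq_zero_iff]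
  constructor
  · exact fun h => h.2
  · rintro rfl; simp

variable {r n : ℕ} {K : PreAbstractSimplicialComplex V}

/-- A multiset of vectors that form a face of the edgewise subdivision is the standard
decomposition of its total. -/
lemma eq_sum_single_part {l : (V → ℕ) →₀ ℕ} (hl : l.support ∈ (edgewise r K).faces) :
    l = ∑ j : Fin l.degree, Finsupp.single (part l.degree (total l) j) 1 := by
  -- For two vectors whose partial sums differ by a 0/1-vector, the total of the partial sums
  -- decides which is the larger.
  obtain ⟨b, hb, hmono⟩ := exists_monotone_tuple (fun a => ∑ v, sumLE a v) l
  have hmem : ∀ j, b j ∈ l.support := by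
    intro j
    rw [Finsupp.mem_support_iff, hb, Finsupp.finsetSum_apply]
    refine (Finset.sum_pos' (fun _ _ => Nat.zero_le _) ⟨j, Finset.mem_univ j, ?_⟩).ne'
    simp
  have hcomp : ∀ i j, i ≤ j → ∀ v,
      sumLE (b i) v ≤ sumLE (b j) v ∧ sumLE (b j) v ≤ sumLE (b i) v + 1 := by
    intro i j hij
    have hle : ∑ v, sumLE (b i) v ≤ ∑ v, sumLE (b j) v := hmono hij
    have h01 := hl.2.2.2 (b i) (hmem i) (b j) (hmem j)
    simp only [partialSums_eq, Set.mem_insert_iff, Set.mem_singleton_iff] at h01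
    rcases h01 with h | h
    -- The coordinatewise order opposes the sorted one, so the two vectors of partial sums coincide.
    · have h1 : ∀ v ∈ Finset.univ, sumLE (b j) v ≤ sumLE (b i) v := fun v _ => by
        have := h v; omega
      have h2 := (Finset.sum_eq_sum_iff_of_le h1).1 (le_antisymm (Finset.sum_le_sum h1) hle)
      intro v
      have := h2 v (Finset.mem_univ v)
      omega
    · intro v
      have := h v
      omega
  have htot : total l = ∑ j, b j := by
    conv_lhs => rw [hb]
    exact total_sum_single _ _
  have hpart : ∀ j, b j = part l.degree (total l) j := by
    intro j
    apply sumLE_injective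
    funext v
    rw [sumLE_part j.isLt, htot, sumLE_sum]
    exact eq_add_div_of_monotone (fun i => sumLE (b i) v) (fun i j hij => hcomp i j hij v) j
  conv_lhs => rw [hb]
  exact Finset.sum_congr rfl fun j _ => by rw [← hpart j]

lemma support_sum_single {W ι : Type*} [DecidableEq W] (s : Finset ι) (b : ι → W) :
    (∑ i ∈ s, Finsupp.single (b i) 1 : W →₀ ℕ).support = s.image b := by
  ext w
  rw [Finsupp.mem_support_iff, Finsupp.finsetSum_apply, Ne, Finset.sum_eq_zero_iff,
    Finset.mem_image]
  simp [Finsupp.single_apply]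

omit [LinearOrder V] in
lemma sum_total {l : (V → ℕ) →₀ ℕ} (hl : ∀ b ∈ l.support, ∑ v, b v = r) :
    ∑ v, total l v = r * l.degree := by
  simp only [total, Finsupp.sum, Finset.sum_apply, Pi.smul_apply, smul_eq_mul]
  rw [Finset.sum_comm, Finsupp.degree_apply, Finset.mul_sum]
  refine Finset.sum_congr rfl fun b hb => ?_
  rw [← Finset.mul_sum, hl b hb, mul_comm]

lemma supp_total (l : (V → ℕ) →₀ ℕ) : supp (total l) = l.support.biUnion supp := by
  ext v
  simp only [mem_supp, total, Finsupp.sum, Finset.sum_apply, Pi.smul_apply, smul_eq_mul, Ne,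
    Finset.sum_eq_zero_iff, Finset.mem_biUnion, mul_eq_zero, not_forall]
  constructor
  · rintro ⟨b, hb, h⟩
    exact ⟨b, hb, fun h0 => h (Or.inr h0)⟩
  · rintro ⟨b, hb, h⟩
    exact ⟨b, hb, by simp [h, Finsupp.mem_support_iff.1 hb]⟩

/-- Offsets below n differ by less than n, so the rounded partial sums differ by 0 or 1. Each part
has sum (rn + j) / n = r ≥ 1, hence nonempty support, as `K.faces` requires. -/
lemma image_part_mem_edgewise (hr : 1 ≤ r) (hn : 0 < n) {a : V → ℕ} (ha : supp a ∈ K.faces)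
    (hsum : ∑ v, a v = r * n) :
    Finset.univ.image (fun j : Fin n => part n a j) ∈ (edgewise r K).faces := by
  have hpart : ∀ j : Fin n, ∑ v, part n a j v = r := by
    intro j
    rw [sum_part j.isLt, hsum, mul_comm, Nat.mul_add_div hn, Nat.div_eq_of_lt j.isLt, add_zero]
  have hne : ∀ j : Fin n, (supp (part n a j)).Nonempty := by
    intro j
    by_contra h0
    rw [Finset.not_nonempty_iff_eq_empty] at h0
    have : ∑ v, part n a j v = 0 := Finset.sum_eq_zero fun v _ => by
      by_contra hv
      have : v ∈ supp (part n a j) := mem_supp.2 hv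
      simp [h0] at this
    have := hpart j
    omega
  have hsub : ∀ j : Fin n, supp (part n a j) ⊆ supp a := by
    intro j v hv
    rw [mem_supp] at hv ⊢
    intro h0
    rw [← sum_range_part hn a v, Finset.sum_eq_zero_iff] at h0
    exact hv (h0 j (Finset.mem_range.2 j.isLt))
  have hzero : part n a 0 ∈ Finset.univ.image (fun j : Fin n => part n a j) :=
    Finset.mem_image.2 ⟨⟨0, hn⟩, Finset.mem_univ _, rfl⟩
  refine ⟨⟨_, hzero⟩, ?_, ?_, ?_⟩
  · intro b hb
    obtain ⟨j, -, rfl⟩ := Finset.mem_image.1 hb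
    exact ⟨hpart j, face_of_subset ha (hsub j) (hne j)⟩
  · refine face_of_subset ha ?_ ?_
    · rw [Finset.biUnion_subset]
      intro b hb
      obtain ⟨j, -, rfl⟩ := Finset.mem_image.1 hb
      exact hsub j
    · exact (hne ⟨0, hn⟩).mono (Finset.subset_biUnion_of_mem supp hzero)
  · have key : ∀ i j : Fin n, i ≤ j → ∀ v,
        partialSums (part n a j) v - partialSums (part n a i) v ∈ ({0, 1} : Set ℤ) := by
      intro i j hij v
      rw [partialSums_eq, partialSums_eq, sumLE_part i.isLt, sumLE_part j.isLt]
      have h1 : (sumLE a v + i) / n ≤ (sumLE a v + j) / n :=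
        Nat.div_le_div_right (Nat.add_le_add_left hij _)
      have h2 : (sumLE a v + j) / n ≤ (sumLE a v + i) / n + 1 := by
        rw [← Nat.add_div_right _ hn]
        exact Nat.div_le_div_right (by omega)
      simp only [Set.mem_insert_iff, Set.mem_singleton_iff]
      omega
    intro b hb c hc
    obtain ⟨i, -, rfl⟩ := Finset.mem_image.1 hb
    obtain ⟨j, -, rfl⟩ := Finset.mem_image.1 hc
    rcases le_total i j with hij | hij
    · exact Or.inr (key i j hij)
    · exact Or.inl (key j i hij)

/-- The edgewise subdivision takes the Hilbert function to its Veronese subsequence. -/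
lemma hilbertFunction_edgewise (hr : 1 ≤ r) (K : PreAbstractSimplicialComplex V) (n : ℕ) :
    hilbertFunction (edgewise r K) n = hilbertFunction K (r * n) := by
  rcases Nat.eq_zero_or_pos n with rfl | hn
  · rw [mul_zero, hilbertFunction_zero, hilbertFunction_zero]
  have hface : ∀ {l : (V → ℕ) →₀ ℕ}, (l.support = ∅ ∨ l.support ∈ (edgewise r K).faces) ∧
      l.degree = n → l.support ∈ (edgewise r K).faces := by
    rintro l ⟨h0 | h0, h1⟩
    · rw [Finsupp.degree_apply, h0] at h1
      simp at h1
      omega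
    · exact h0
  have hsupp : ∀ a : V → ℕ, (Finsupp.equivFunOnFinite.symm a).support = supp a := by
    intro a; ext v; simp [mem_supp]
  -- The bijection is the total of a multiset; its inverse is the decomposition into `part`s.
  refine Set.ncard_congr (fun l _ => Finsupp.equivFunOnFinite.symm (total l)) ?_ ?_ ?_
  · intro l hl
    have hf := hface hl
    refine ⟨Or.inr ?_, ?_⟩
    · rw [hsupp, supp_total]
      exact hf.2.2.1
    · rw [Finsupp.degree_eq_sum]
      simpa [hl.2] using sum_total fun b hb => (hf.2.1 b hb).1
  · intro l m hl hm hlm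
    have h1 := eq_sum_single_part (hface hl)
    have h2 := eq_sum_single_part (hface hm)
    rw [Finsupp.equivFunOnFinite.symm.injective hlm, hl.2] at h1
    rw [hm.2] at h2
    exact h1.trans h2.symm
  · rintro a ⟨ha, hdeg⟩
    have hsum : ∑ v, a v = r * n := by rw [← hdeg, Finsupp.degree_eq_sum]
    have ha' : supp ⇑a ∈ K.faces := by
      have h0 : a.support = supp ⇑a := by ext v; simp [mem_supp]
      rcases ha with ha | ha
      · rw [Finsupp.support_eq_empty] at ha
        subst ha
        have := Nat.mul_pos hr hn
        simp at hsum
        omega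
      · rwa [← h0]
    refine ⟨∑ j : Fin n, Finsupp.single (part n a j) 1, ⟨Or.inr ?_, ?_⟩, ?_⟩
    · rw [support_sum_single]
      exact image_part_mem_edgewise hr hn ha' hsum
    · simp
    · rw [total_sum_single]
      ext v
      simp only [Finsupp.equivFunOnFinite_symm_apply_apply, Finset.sum_apply]
      rw [Fin.sum_univ_eq_sum_range (fun j => part n a j v) n]
      exact sum_range_part hn a v

end

/-! ### Toeplitz matrices: total nonnegativity and symmetry -/

/-- The polynomial `1 + x + ⋯ + x^{r-1}`. -/
noncomputable def geomPoly (r : ℕ) : ℚ[X] := ∑ j ∈ Finset.range r, X ^ j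

/-- The Toeplitz matrix of `(1 + x + ⋯ + x^{r-1})^d`. -/
noncomputable def toeplitz (r d a b : ℕ) : ℚ := (geomPoly r ^ d * X ^ b).coeff a

lemma coeff_geomPoly (r m : ℕ) : (geomPoly r).coeff m = if m < r then 1 else 0 := by
  simp [geomPoly, coeff_X_pow]

lemma toeplitz_one (r a b : ℕ) :
    toeplitz r 1 a b = if b ≤ a ∧ a < b + r then 1 else 0 := by
  rw [toeplitz, pow_one, coeff_mul_X_pow', coeff_geomPoly]
  grind

lemma toeplitz_add (r d a b s : ℕ) : toeplitz r d (a + s) (b + s) = toeplitz r d a b := by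
  rw [toeplitz, toeplitz, pow_add, ← mul_assoc, coeff_mul_X_pow]

lemma coeff_mul_eq_sum_range (p q : ℚ[X]) {a N : ℕ} (ha : a < N) :
    (p * q).coeff a = ∑ k ∈ Finset.range N, (p * X ^ k).coeff a * q.coeff k := by
  rw [mul_comm, coeff_mul, Finset.Nat.sum_antidiagonal_eq_sum_range_succ_mk]
  rw [← Finset.sum_subset (Finset.range_subset_range.2 (Nat.succ_le_of_lt ha))]
  · refine Finset.sum_congr rfl fun k hk => ?_
    rw [coeff_mul_X_pow', if_pos (Nat.lt_succ_iff.1 (Finset.mem_range.1 hk)), mul_comm]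
  · intro k _ hk
    have : ¬ k ≤ a := fun h => hk (Finset.mem_range.2 (Nat.lt_succ_of_le h))
    rw [coeff_mul_X_pow', if_neg this, zero_mul]

/-- Multiplying polynomials multiplies Toeplitz matrices. These are lower triangular, so any cutoff
N > a is allowed and two rows can share one. -/
lemma toeplitz_succ (r d b : ℕ) {a N : ℕ} (ha : a < N) :
    toeplitz r (d + 1) a b =
      ∑ k ∈ Finset.range N, toeplitz r 1 a k * toeplitz r d k b := by
  rw [toeplitz, pow_succ', mul_assoc, coeff_mul_eq_sum_range _ _ ha]
  simp [toeplitz]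

/-- The `2 × 2` case of the Cauchy-Binet inequality. -/
lemma sum_mul_sum_le_of_minors_nonneg {N : ℕ} {u v g w : ℕ → ℚ}
    (huv : ∀ k l, k < l → l < N → u l * v k ≤ u k * v l)
    (hgw : ∀ k l, k < l → l < N → g l * w k ≤ g k * w l) :
    (∑ k ∈ Finset.range N, u k * w k) * (∑ k ∈ Finset.range N, v k * g k) ≤
      (∑ k ∈ Finset.range N, u k * g k) * (∑ k ∈ Finset.range N, v k * w k) := by
  -- Swapping k and l changes the sign of both factors, so the full double sum is twice the
  -- Cauchy-Binet sum over k < l.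
  have key : 0 ≤ ∑ k ∈ Finset.range N, ∑ l ∈ Finset.range N,
      (u k * v l - u l * v k) * (g k * w l - g l * w k) := by
    refine Finset.sum_nonneg fun k hk => Finset.sum_nonneg fun l hl => ?_
    rw [Finset.mem_range] at hk hl
    rcases lt_trichotomy k l with hkl | rfl | hkl
    · exact mul_nonneg (sub_nonneg.2 (huv k l hkl hl)) (sub_nonneg.2 (hgw k l hkl hl))
    · simp
    · exact mul_nonneg_of_nonpos_of_nonpos (sub_nonpos.2 (huv l k hkl hk))
        (sub_nonpos.2 (hgw l k hkl hk))
  have expand : ∑ k ∈ Finset.range N, ∑ l ∈ Finset.range N,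
      (u k * v l - u l * v k) * (g k * w l - g l * w k) =
      2 * ((∑ k ∈ Finset.range N, u k * g k) * (∑ k ∈ Finset.range N, v k * w k) -
        (∑ k ∈ Finset.range N, u k * w k) * (∑ k ∈ Finset.range N, v k * g k)) := by
    have h1 : ∀ k l, (u k * v l - u l * v k) * (g k * w l - g l * w k) =
        (u k * g k) * (v l * w l) - (u k * w k) * (v l * g l) -
          (v k * g k) * (u l * w l) + (v k * w k) * (u l * g l) := by
      intro k l; ring
    simp_rw [h1, Finset.sum_add_distrib, Finset.sum_sub_distrib, ← Finset.sum_mul_sum]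
    ring
  linarith

/-- Cauchy-Binet passes nonnegative minors to products, starting from the identity matrix. The
factor for exponent 1 is a band of ones: ones at (a, l) and (a', k) with a < a' and k < l force ones
at (a, k) and (a', l). -/
lemma toeplitz_minor_nonneg (r d : ℕ) {a a' b b' : ℕ} (ha : a < a') (hb : b < b') :
    toeplitz r d a b' * toeplitz r d a' b ≤ toeplitz r d a b * toeplitz r d a' b' := by
  induction d generalizing a a' b b' with
  | zero =>
    simp only [toeplitz, pow_zero, one_mul, coeff_X_pow]
    split_ifs <;> first | omega | norm_num
  | succ d ih =>
    rw [toeplitz_succ r d b' (ha.trans a'.lt_succ_self),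
      toeplitz_succ r d b (ha.trans a'.lt_succ_self),
      toeplitz_succ r d b' a'.lt_succ_self, toeplitz_succ r d b a'.lt_succ_self]
    refine sum_mul_sum_le_of_minors_nonneg (fun k l hkl _ => ?_) fun k l hkl _ => ?_
    · simp only [toeplitz_one]
      split_ifs <;> first | omega | norm_num
    · rw [mul_comm (toeplitz r d l b)]
      exact ih hkl hb

lemma coeff_geomPoly_pow_nonneg (r d m : ℕ) : 0 ≤ (geomPoly r ^ d).coeff m := by
  induction d generalizing m with
  | zero => rw [pow_zero, coeff_one]; split_ifs <;> norm_num
  | succ d ih =>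
    rw [pow_succ, coeff_mul]
    refine Finset.sum_nonneg fun x _ => mul_nonneg (ih _) ?_
    rw [coeff_geomPoly]; split_ifs <;> norm_num

lemma toeplitz_nonneg (r d a b : ℕ) : 0 ≤ toeplitz r d a b := by
  rw [toeplitz, coeff_mul_X_pow']
  split_ifs
  exacts [coeff_geomPoly_pow_nonneg _ _ _, le_rfl]

/-- Take x^(r-1) from i of the d factors and 1 from the others. -/
lemma coeff_geomPoly_pow_pos {r d i : ℕ} (hr : 1 ≤ r) (hi : i ≤ d) :
    0 < (geomPoly r ^ d).coeff ((r - 1) * i) := by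
  induction d generalizing i with
  | zero =>
    obtain rfl : i = 0 := by omega
    simp
  | succ d ih =>
    have hnn : ∀ x ∈ Finset.HasAntidiagonal.antidiagonal ((r - 1) * i),
        0 ≤ (geomPoly r ^ d).coeff x.1 * (geomPoly r).coeff x.2 := by
      intro x _
      refine mul_nonneg (coeff_geomPoly_pow_nonneg _ _ _) ?_
      rw [coeff_geomPoly]; split_ifs <;> norm_num
    rw [pow_succ, coeff_mul]
    refine Finset.sum_pos' hnn ?_
    rcases Nat.lt_or_ge d i with h1 | h1
    · obtain rfl : i = d + 1 := by omega
      refine ⟨((r - 1) * d, r - 1), by simp [mul_add], ?_⟩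
      refine mul_pos (ih le_rfl) ?_
      rw [coeff_geomPoly, if_pos (by omega)]; norm_num
    · refine ⟨((r - 1) * i, 0), by simp, ?_⟩
      refine mul_pos (ih h1) ?_
      rw [coeff_geomPoly, if_pos (by omega)]; norm_num

lemma toeplitz_diag_pos {r d i : ℕ} (hr : 1 ≤ r) (hi : i ≤ d) : 0 < toeplitz r d (r * i) i := by
  obtain ⟨s, rfl⟩ := Nat.exists_eq_add_of_le' hr
  have := coeff_geomPoly_pow_pos hr hi
  rw [toeplitz, show (s + 1) * i = (s + 1 - 1) * i + i by simp; ring, coeff_mul_X_pow]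
  exact this

lemma natDegree_geomPoly_le (r : ℕ) : (geomPoly r).natDegree ≤ r - 1 := by
  refine natDegree_sum_le_of_forall_le _ _ fun i hi => (natDegree_X_pow_le i).trans ?_
  have := Finset.mem_range.1 hi
  omega

lemma natDegree_geomPoly_pow_le (r d : ℕ) : (geomPoly r ^ d).natDegree ≤ d * (r - 1) :=
  natDegree_pow_le_of_le d (natDegree_geomPoly_le r)

lemma reflect_geomPoly_pow {r : ℕ} (hr : 1 ≤ r) (d : ℕ) :
    reflect (d * (r - 1)) (geomPoly r ^ d) = geomPoly r ^ d := by
  induction d with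
  | zero => simp
  | succ d ih =>
    have h1 : reflect (r - 1) (geomPoly r) = geomPoly r := by
      ext m
      rw [coeff_reflect, coeff_geomPoly, coeff_geomPoly]
      by_cases hm : m ≤ r - 1
      · rw [revAt_le hm, if_pos (by omega), if_pos (by omega)]
      · rw [revAt_eq_self_of_lt (by omega)]
    rw [pow_succ, Nat.succ_mul, reflect_mul _ _ (natDegree_geomPoly_pow_le r d)
      (natDegree_geomPoly_le r), ih, h1]

/-- Palindromicity exchanges the coefficients at a - b and d(r-1) - (a - b); outside the range 0, …,
d(r-1) both vanish. -/
lemma toeplitz_symm {r : ℕ} (hr : 1 ≤ r) (d a b : ℕ) :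
    toeplitz r d (b + d * (r - 1)) a = toeplitz r d a b := by
  have hbig : ∀ m, d * (r - 1) < m → (geomPoly r ^ d).coeff m = 0 := fun m hm =>
    coeff_eq_zero_of_natDegree_lt ((natDegree_geomPoly_pow_le r d).trans_lt hm)
  rw [toeplitz, toeplitz, coeff_mul_X_pow', coeff_mul_X_pow']
  split_ifs with h1 h2 h2
  · conv_rhs => rw [← reflect_geomPoly_pow hr d]
    rw [coeff_reflect, revAt_le (by omega)]
    congr 1; omega
  · exact hbig _ (by omega)
  · exact (hbig _ (by omega)).symm
  · rfl

/-- This is the palindromic symmetry, as r(d - i) - (d - k) = d(r-1) - (ri - k). -/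
lemma toeplitz_reverse {r d i k : ℕ} (hr : 1 ≤ r) (hi : i ≤ d) (hk : k ≤ d) :
    toeplitz r d (r * (d - i)) (d - k) = toeplitz r d (r * i) k := by
  obtain ⟨e, rfl⟩ := Nat.exists_eq_add_of_le hi
  obtain ⟨s, rfl⟩ := Nat.exists_eq_add_of_le' hr
  rw [← toeplitz_symm hr _ ((s + 1) * i) k, ← toeplitz_add _ _ _ (i + e - k) ((s + 1) * i + k),
    ← toeplitz_add _ _ (k + _) ((s + 1) * i) (i + e)]
  congr 1
  · simp; ring
  · omega

/-! ### Sampling every r-th coefficient of a rational series -/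

/-- The power series with every `r`-th coefficient of a given one. -/
noncomputable def veronese (r : ℕ) (f : PowerSeries ℚ) : PowerSeries ℚ :=
  PowerSeries.mk fun m => PowerSeries.coeff (r * m) f

/-- A shift by r becomes a shift by one after sampling. -/
lemma veronese_one_sub_X_pow_mul {r : ℕ} (hr : 1 ≤ r) (f : PowerSeries ℚ) :
    veronese r ((1 - PowerSeries.X ^ r) * f) = (1 - PowerSeries.X) * veronese r f := by
  ext m
  rw [veronese, PowerSeries.coeff_mk, sub_mul, sub_mul, one_mul, one_mul, map_sub, map_sub,
    PowerSeries.coeff_X_pow_mul']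
  cases m with
  | zero =>
    rw [mul_zero, if_neg (by omega)]
    simp [veronese]
  | succ m =>
    rw [if_pos (by nlinarith), PowerSeries.coeff_succ_X_mul, veronese, PowerSeries.coeff_mk,
      PowerSeries.coeff_mk]
    congr 2
    rw [mul_add, mul_one, Nat.add_sub_cancel]

lemma veronese_one_sub_X_pow_pow_mul {r : ℕ} (hr : 1 ≤ r) (d : ℕ) (f : PowerSeries ℚ) :
    veronese r ((1 - PowerSeries.X ^ r) ^ d * f) = (1 - PowerSeries.X) ^ d * veronese r f := by
  induction d with
  | zero => simp
  | succ d ih => rw [pow_succ', mul_assoc, veronese_one_sub_X_pow_mul hr, ih, pow_succ', mul_assoc]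

/-- The polynomial with every `r`-th coefficient of `(1 + x + ⋯ + x^{r-1})^d p`. -/
noncomputable def veronesePoly (r d : ℕ) (p : ℚ[X]) : ℚ[X] :=
  ∑ m ∈ Finset.range (d + 1), C ((geomPoly r ^ d * p).coeff (r * m)) * X ^ m

lemma coeff_veronesePoly {r d m : ℕ} (p : ℚ[X]) (hm : m ≤ d) :
    (veronesePoly r d p).coeff m = (geomPoly r ^ d * p).coeff (r * m) := by
  simp [veronesePoly, coeff_X_pow, hm]

lemma one_sub_X_pow_mul_veronese {r d : ℕ} (hr : 1 ≤ r) {p : ℚ[X]} (hp : p.natDegree ≤ d)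
    {f : PowerSeries ℚ} (hf : (1 - PowerSeries.X) ^ d * f = (p : PowerSeries ℚ)) :
    (1 - PowerSeries.X) ^ d * veronese r f = (veronesePoly r d p : PowerSeries ℚ) := by
  have hgeom : ((geomPoly r * (1 - X) : ℚ[X]) : PowerSeries ℚ) = 1 - PowerSeries.X ^ r := by
    rw [geomPoly, geom_sum_mul_neg]
    simp
  have h1 : (1 - PowerSeries.X ^ r) ^ d * f = ((geomPoly r ^ d * p : ℚ[X]) : PowerSeries ℚ) := by
    rw [← hgeom, Polynomial.coe_mul, Polynomial.coe_mul, ← hf, Polynomial.coe_pow]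
    simp only [Polynomial.coe_sub, Polynomial.coe_one, Polynomial.coe_X]
    rw [mul_pow]
    ring
  rw [← veronese_one_sub_X_pow_pow_mul hr, h1]
  ext m
  rw [veronese, PowerSeries.coeff_mk, Polynomial.coeff_coe, Polynomial.coeff_coe]
  rcases le_or_gt m d with hm | hm
  · rw [coeff_veronesePoly p hm]
  · have h2 : (veronesePoly r d p).coeff m = 0 := by
      simp [veronesePoly, coeff_X_pow, hm]
    rw [h2]
    -- The degree is at most d(r-1) + d = rd < rm, so cutting `veronesePoly` off at d loses nothing.
    refine coeff_eq_zero_of_natDegree_lt ?_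
    refine (natDegree_mul_le_of_le (natDegree_geomPoly_pow_le r d) hp).trans_lt ?_
    obtain ⟨s, rfl⟩ := Nat.exists_eq_add_of_le' hr
    simp only [Nat.add_sub_cancel]
    nlinarith

lemma coeff_geomPoly_pow_mul {r d a : ℕ} {p : ℚ[X]} (hp : p.natDegree ≤ d) :
    (geomPoly r ^ d * p).coeff a =
      ∑ k ∈ Finset.range (d + 1), toeplitz r d a k * p.coeff k := by
  conv_lhs => rw [p.as_sum_range_C_mul_X_pow' (Nat.lt_succ_of_le hp), Finset.mul_sum]
  rw [finsetSum_coeff]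
  refine Finset.sum_congr rfl fun k _ => ?_
  rw [mul_left_comm, coeff_C_mul, toeplitz, mul_comm]

/-- The order of the pole at `1` of a rational function is well defined. -/
lemma not_lt_of_one_sub_X_pow_mul_eq {d e : ℕ} {p q : ℚ[X]} {f : PowerSeries ℚ}
    (hp : (1 - PowerSeries.X) ^ d * f = (p : PowerSeries ℚ)) (hq : (1 - PowerSeries.X) ^ e * f = (q : PowerSeries ℚ))
    (hq1 : q.eval 1 ≠ 0) : ¬ d < e := by
  intro hde
  obtain ⟨c, rfl⟩ := Nat.exists_eq_add_of_lt hde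
  have h1 : q = (1 - X) ^ (c + 1) * p := by
    apply Polynomial.coe_injective
    rw [← hq, Polynomial.coe_mul, ← hp, Polynomial.coe_pow]
    simp only [Polynomial.coe_sub, Polynomial.coe_one, Polynomial.coe_X]
    ring
  exact hq1 (by simp [h1])

/-! ### The h-vector of the subdivision and the ratio conditions -/

section

variable {V : Type*} [Fintype V] {K : PreAbstractSimplicialComplex V}

lemma h_zero : h K 0 = 1 := by
  rw [h_eq_coeff_hRev (Nat.zero_le _)]
  have h1 := congrArg (PowerSeries.coeff 0) (one_sub_X_pow_mul_hilbertSeries K.faces.toFinite)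
  rw [Polynomial.coeff_coe] at h1
  rw [← h1]
  simp [hilbertFunction_zero]

variable [LinearOrder V] {r : ℕ}

/-- The Hilbert series of the subdivision is written over (1 - x)^d in two ways, with d the rank of
either complex. Both numerators are nonzero at 1, so the ranks agree and then the numerators do.
Nonnegativity of h ensures this for the sampled one, whose value at 1 includes the positive term
T(0, 0) h_0. -/
lemma hRev_edgewise (hr : 1 ≤ r) (hh : ∀ i ≤ rank K, 0 ≤ h K i) :
    rank (edgewise r K) = rank K ∧
      hRev (edgewise r K) = veronesePoly r (rank K) (hRev K) := by
  have h1 := one_sub_X_pow_mul_veronese hr natDegree_hRev_le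
    (one_sub_X_pow_mul_hilbertSeries K.faces.toFinite)
  have h2 := one_sub_X_pow_mul_hilbertSeries (finite_faces_edgewise r K)
  have h3 : PowerSeries.mk (fun n => (hilbertFunction (edgewise r K) n : ℚ)) =
      veronese r (PowerSeries.mk fun n => (hilbertFunction K n : ℚ)) := by
    ext n
    rw [veronese, PowerSeries.coeff_mk, PowerSeries.coeff_mk, PowerSeries.coeff_mk,
      hilbertFunction_edgewise hr]
  rw [h3] at h2
  have hnn : ∀ a, ∀ k ∈ Finset.range (rank K + 1),
      0 ≤ toeplitz r (rank K) a k * (hRev K).coeff k := by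
    intro a k hk
    have hk := Nat.lt_succ_iff.1 (Finset.mem_range.1 hk)
    rw [← h_eq_coeff_hRev hk]
    exact mul_nonneg (toeplitz_nonneg _ _ _ _) (hh k hk)
  have hpos : 0 < (veronesePoly r (rank K) (hRev K)).eval 1 := by
    simp only [veronesePoly, eval_finsetSum, eval_mul, eval_C, eval_pow, eval_X, one_pow, mul_one,
      coeff_geomPoly_pow_mul natDegree_hRev_le]
    refine Finset.sum_pos' (fun m _ => Finset.sum_nonneg (hnn _)) ⟨0, by simp, ?_⟩
    refine Finset.sum_pos' (hnn _) ⟨0, by simp, ?_⟩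
    rw [← h_eq_coeff_hRev (Nat.zero_le _), h_zero, mul_one]
    exact toeplitz_diag_pos hr (Nat.zero_le _)
  have hpos' : (hRev (edgewise r K)).eval 1 ≠ 0 := by
    rw [eval_one_hRev]
    exact_mod_cast (faceCount_rank_pos (finite_faces_edgewise r K)).ne'
  have hrank : rank (edgewise r K) = rank K :=
    le_antisymm (not_lt.1 (not_lt_of_one_sub_X_pow_mul_eq h1 h2 hpos'))
      (not_lt.1 (not_lt_of_one_sub_X_pow_mul_eq h2 h1 hpos.ne'))
  refine ⟨hrank, Polynomial.coe_injective _ ?_⟩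
  rw [← h1, ← h2, hrank]

lemma h_edgewise (hr : 1 ≤ r) (hh : ∀ i ≤ rank K, 0 ≤ h K i) {i : ℕ} (hi : i ≤ rank K) :
    h (edgewise r K) i =
      ∑ k ∈ Finset.range (rank K + 1), toeplitz r (rank K) (r * i) k * h K k := by
  obtain ⟨h1, h2⟩ := hRev_edgewise hr hh
  rw [h_eq_coeff_hRev (h1 ▸ hi), h2, coeff_veronesePoly _ hi,
    coeff_geomPoly_pow_mul natDegree_hRev_le]
  refine Finset.sum_congr rfl fun k hk => ?_
  rw [h_eq_coeff_hRev (Nat.lt_succ_iff.1 (Finset.mem_range.1 hk))]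

lemma h_edgewise_reverse (hr : 1 ≤ r) (hh : ∀ i ≤ rank K, 0 ≤ h K i) {i : ℕ} (hi : i ≤ rank K) :
    h (edgewise r K) (rank K - i) =
      ∑ k ∈ Finset.range (rank K + 1), toeplitz r (rank K) (r * i) k * h K (rank K - k) := by
  rw [h_edgewise hr hh (Nat.sub_le _ _), ← Finset.sum_range_reflect]
  refine Finset.sum_congr rfl fun k hk => ?_
  have hk := Nat.lt_succ_iff.1 (Finset.mem_range.1 hk)
  rw [Nat.add_sub_cancel, toeplitz_reverse hr hi hk]

lemma h_edgewise_pos (hr : 1 ≤ r) (hh : ∀ i ≤ rank K, 0 ≤ h K i) {i : ℕ} (hi : i ≤ rank K)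
    (hpos : 0 < h K i) : 0 < h (edgewise r K) i := by
  rw [h_edgewise hr hh hi]
  refine Finset.sum_pos' (fun k hk => mul_nonneg (toeplitz_nonneg _ _ _ _)
    (hh k (Nat.lt_succ_iff.1 (Finset.mem_range.1 hk)))) ⟨i, Finset.mem_range.2 (by omega), ?_⟩
  exact mul_pos (toeplitz_diag_pos hr hi) hpos

/-- In row rd an entry in column k < d is zero, because d(r-1) + k < rd; only h_d contributes. -/
lemma h_edgewise_rank (hr : 1 ≤ r) (hh : ∀ i ≤ rank K, 0 ≤ h K i) (h0 : h K (rank K) = 0) :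
    h (edgewise r K) (rank K) = 0 := by
  rw [h_edgewise hr hh le_rfl]
  refine Finset.sum_eq_zero fun k hk => ?_
  rcases (Nat.lt_succ_iff.1 (Finset.mem_range.1 hk)).eq_or_lt with rfl | hlt
  · rw [h0, mul_zero]
  · have : toeplitz r (rank K) (r * rank K) k = 0 := by
      rw [toeplitz]
      refine coeff_eq_zero_of_natDegree_lt ((natDegree_mul_le_of_le
        (natDegree_geomPoly_pow_le r _) (natDegree_X_pow_le k)).trans_lt ?_)
      obtain ⟨s, rfl⟩ := Nat.exists_eq_add_of_le' hr
      simp only [Nat.add_sub_cancel]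
      nlinarith
    rw [this, zero_mul]

lemma toeplitz_row_minor_nonneg (hr : 1 ≤ r) (d i : ℕ) (k l : ℕ) (hkl : k < l) :
    toeplitz r d (r * i) l * toeplitz r d (r * (i + 1)) k ≤
      toeplitz r d (r * i) k * toeplitz r d (r * (i + 1)) l :=
  toeplitz_minor_nonneg r d (Nat.mul_lt_mul_of_pos_left i.lt_succ_self hr) hkl

/-- Cauchy-Binet for rows ri and r(i+1) of T against the columns (h_(d-k)) and (h_k). -/
lemma h_edgewise_mul_le (hr : 1 ≤ r) (hh : ∀ i ≤ rank K, 0 ≤ h K i)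
    (hK : ∀ k l, k < l → l < rank K + 1 →
      h K (rank K - l) * h K k ≤ h K (rank K - k) * h K l) {i : ℕ} (hi : i + 1 ≤ rank K) :
    h (edgewise r K) i * h (edgewise r K) (rank K - (i + 1)) ≤
      h (edgewise r K) (rank K - i) * h (edgewise r K) (i + 1) := by
  have hi' : i ≤ rank K := by omega
  rw [h_edgewise_reverse hr hh hi, h_edgewise_reverse hr hh hi', h_edgewise hr hh hi,
    h_edgewise hr hh hi']
  exact sum_mul_sum_le_of_minors_nonneg
    (fun k l hkl _ => toeplitz_row_minor_nonneg hr _ i k l hkl) hK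

/-- The same argument with the two columns exchanged. -/
lemma le_h_edgewise_mul (hr : 1 ≤ r) (hh : ∀ i ≤ rank K, 0 ≤ h K i)
    (hK : ∀ k l, k < l → l < rank K + 1 →
      h K l * h K (rank K - k) ≤ h K k * h K (rank K - l)) {i : ℕ} (hi : i + 1 ≤ rank K) :
    h (edgewise r K) (rank K - i) * h (edgewise r K) (i + 1) ≤
      h (edgewise r K) i * h (edgewise r K) (rank K - (i + 1)) := by
  have hi' : i ≤ rank K := by omega
  rw [h_edgewise_reverse hr hh hi, h_edgewise_reverse hr hh hi', h_edgewise hr hh hi,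
    h_edgewise hr hh hi']
  exact sum_mul_sum_le_of_minors_nonneg
    (fun k l hkl _ => toeplitz_row_minor_nonneg hr _ i k l hkl) hK

lemma increasingRatios_edgewise (hr : 1 ≤ r) (hK : IncreasingRatios K) :
    IncreasingRatios (edgewise r K) := by
  obtain ⟨hpos, hratio⟩ := hK
  have hh : ∀ i ≤ rank K, 0 ≤ h K i := fun i hi => (hpos i hi).le
  have hpos' : ∀ i ≤ rank K, 0 < h (edgewise r K) i := fun i hi =>
    h_edgewise_pos hr hh hi (hpos i hi)
  rw [IncreasingRatios, (hRev_edgewise hr hh).1]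
  refine ⟨hpos', fun i hi => ?_⟩
  rw [div_le_div_iff₀ (hpos' _ (Nat.sub_le _ _)) (hpos' _ (Nat.sub_le _ _)),
    mul_comm (h _ (i + 1))]
  refine h_edgewise_mul_le hr hh (fun k l hkl hl => ?_) hi
  have hchain : h K k / h K (rank K - k) ≤ h K l / h K (rank K - l) := by
    induction l, hkl using Nat.le_induction with
    | base => exact hratio k (by omega)
    | succ l hkl ih => exact (ih (by omega)).trans (hratio l (by omega))
  rw [div_le_div_iff₀ (hpos _ (Nat.sub_le _ _)) (hpos _ (Nat.sub_le _ _))] at hchain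
  linarith

lemma decreasingRatios_edgewise (hr : 1 ≤ r) (hK : DecreasingRatios K) :
    DecreasingRatios (edgewise r K) := by
  obtain ⟨hpos, hlast, hratio⟩ := hK
  have hh : ∀ i ≤ rank K, 0 ≤ h K i := by
    intro i hi
    rcases Nat.eq_zero_or_pos i with rfl | h0
    · rw [h_zero]; exact zero_le_one
    · rcases hi.eq_or_lt with rfl | h1
      exacts [hlast.ge, (hpos i h0 h1).le]
  have hpos' : ∀ i, 1 ≤ i → i + 1 ≤ rank K → 0 < h (edgewise r K) i := fun i h1 h2 =>
    h_edgewise_pos hr hh (by omega) (hpos i h1 h2)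
  rw [DecreasingRatios, (hRev_edgewise hr hh).1]
  refine ⟨hpos', h_edgewise_rank hr hh hlast, fun i h1 h2 => ?_⟩
  rw [ge_iff_le, div_le_div_iff₀ (hpos' _ (by omega) (by omega)) (hpos' _ (by omega) (by omega)),
    mul_comm (h _ (i + 1))]
  refine le_h_edgewise_mul hr hh (fun k l hkl hl => ?_) (by omega)
  -- Condition (2) compares no ratios at the indices 0 and d. For k = 0 or l = d the left side has
  -- the factor h_d = 0 and the right side is nonnegative.
  have hnn := mul_nonneg (hh k (by omega)) (hh (rank K - l) (Nat.sub_le _ _))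
  rcases Nat.eq_zero_or_pos k with rfl | hk
  · rwa [Nat.sub_zero, hlast, mul_zero]
  rcases (Nat.lt_succ_iff.1 hl).eq_or_lt with rfl | hl'
  · rwa [hlast, zero_mul]
  have hchain : h K l / h K (rank K - l) ≤ h K k / h K (rank K - k) := by
    clear hl hnn
    induction l, hkl using Nat.le_induction with
    | base => exact hratio k hk (by omega)
    | succ l hkl ih => exact (hratio l (by omega) (by omega)).trans (ih (by omega))
  rwa [div_le_div_iff₀ (hpos _ (by omega) (by omega)) (hpos _ (by omega) (by omega))] at hchain

end

end SimplicialHVector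

open SimplicialHVector in
theorem mainTheorem5 {V : Type*} [Fintype V] [LinearOrder V]
    (Δ : PreAbstractSimplicialComplex V) (r : ℕ) (hr : 1 ≤ r) :
    (IncreasingRatios Δ → IncreasingRatios (edgewise r Δ)) ∧
      (DecreasingRatios Δ → DecreasingRatios (edgewise r Δ)) :=
  ⟨increasingRatios_edgewise hr, decreasingRatios_edgewise hr⟩
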